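/- Let $\kappa$ be an uncountable set, let $A(\kappa)=\kappa\cup\{\infty\}$ be the one-point compactification of the discrete space $\kappa$, and let $$B(\kappa)=\Big\{x\in\mathbb R^\kappa:\ \sum_{i\in\kappa}|x_i|\le 1\Big\},\qquad B^+(\kappa)=\{x\in B(\kappa):\ x_i\ge 0\text{ for all }i\in\kappa\},$$ with the topology of pointwise convergence. For $n\in\mathbb N=\{0,1,2,\dots\}$ let $\sigma_n(\kappa)$ be the compact space of all $x\in\{0,1\}^\kappa$ with at most $n$ nonzero coordinates. For a continuous map $u:X\to Y$ between compact spaces, an averaging operator for $u$ is a bounded linear operator $T:C(X)\to C(Y)$ such that $T(\varphi\circ u)=\varphi$ for all $\varphi\in C(Y)$; here the scalars are either $\mathbb R$ or $\mathbb C$. Let $(r_n)_{n\in\mathbb N}$ be a summable sequence of positive real numbers such that $(t_n)\mapsto\sum_n r_nt_n$ maps $\{0,1\}^{\mathbb N}$ onto $[0,1]$ (for example $r_n=2^{-n-1}$). Put $$Z=\Big\{z\in\mathbb N^{\mathbb N}:\ \sum_{n} r_nz_n\le 1\Big\},\qquad L=Z\times\prod_{n\in\mathbb N}\sigma_n(\kappa)^{\mathbb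 N},$$ write the elements of $L$ as $(z,x)$ with $x=(x[m,n]\in\sigma_n(\kappa))_{m,n\in\mathbb N}$, and define the continuous map $g:L\to B^+(\kappa)$ by $g(z,x)_i=\sum_{m\in\mathbb N} r_m\,x[m,z_m]_i$. For a bijection $e:\kappa\to\kappa\times\{0,1\}$ define the continuous map $q_e:B^+(\kappa)\to B(\kappa)$ by $q_e(x)_i=x_{e^{-1}(i,0)}-x_{e^{-1}(i,1)}$. Then bijections $e:\kappa\to\kappa\times\{0,1\}$ and continuous surjections $h:A(\kappa)^{\mathbb N}\to L$ exist, and for every such $h$ and $e$: 1. $g\circ h:A(\kappa)^{\mathbb N}\to B^+(\kappa)$ is a continuous surjection which does not admit any averaging operator; 2. $f=q_e\circ g\circ h:A(\kappa)^{\mathbb N}\to B(\kappa)$ is a continuous surjection which does not admit any averaging operator. -/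

import Mathlib

open Set

universe u

/-- The ball `B(κ) = {x ∈ ℝ^κ : ∑ |x i| ≤ 1}`, with the topology of pointwise convergence. -/
def ball (κ : Type u) : Set (κ → ℝ) :=
  {x | Summable (fun i => |x i|) ∧ ∑' i, |x i| ≤ 1}

/-- The positive part `B⁺(κ)` of the ball. -/
def posBall (κ : Type u) : Set (κ → ℝ) :=
  {x | x ∈ ball κ ∧ ∀ i, 0 ≤ x i}

/-- `σ_n(κ)`: the points of `{0,1}^κ` whose support has at most `n` elements. -/
def sigmaSpace (n : ℕ) (κ : Type u) : Set (κ → Bool) :=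
  {x | {i | x i = true}.encard ≤ n}

/-- `r` is a sequence of positive reals for which `t ↦ ∑ r n * t n` is a well-defined
(hence continuous) surjection from `{0,1}^ℕ` onto `[0,1]`. -/
def IsDigitSequence (r : ℕ → ℝ) : Prop :=
  (∀ n, 0 < r n) ∧ Summable r ∧
    range (fun t : ℕ → Bool => ∑' n, if t n then r n else 0) = Icc (0 : ℝ) 1

/-- `Z = {z ∈ ℕ^ℕ : ∑ r n * z n ≤ 1}`. -/
def zSpace (r : ℕ → ℝ) : Set (ℕ → ℕ) :=
  {z | Summable (fun n => r n * (z n : ℝ)) ∧ ∑' n, r n * (z n : ℝ) ≤ 1}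

/-- `L = Z × ∏_n σ_n(κ)^ℕ`; the coordinate `x[m,n] ∈ σ_n(κ)` of `p = (z, x)` is `p.2 m n`. -/
abbrev LSpace (r : ℕ → ℝ) (κ : Type u) : Type u :=
  zSpace r × ((_m n : ℕ) → sigmaSpace n κ)

/-- The formula `g(z,x)_i = ∑_m r m * x[m, z m]_i`. -/
noncomputable def gFun (r : ℕ → ℝ) {κ : Type u} (p : LSpace r κ) (i : κ) : ℝ :=
  ∑' m, if (p.2 m (p.1.1 m)).1 i then r m else 0

theorem mem_ball_iff {κ : Type u} {x : κ → ℝ} :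
    x ∈ ball κ ↔ ∀ s : Finset κ, ∑ i ∈ s, |x i| ≤ 1 := by
  constructor
  · rintro ⟨hs, h1⟩ s
    exact (hs.sum_le_tsum s (fun i _ => abs_nonneg _)).trans h1
  · intro h
    exact ⟨summable_of_sum_le (fun i => abs_nonneg _) h,
      Real.tsum_le_of_sum_le (fun i => abs_nonneg _) h⟩

theorem isCompact_ball (κ : Type u) : IsCompact (ball κ) := by
  have hc : IsClosed (ball κ) := by
    have : ball κ = ⋂ s : Finset κ, {x | ∑ i ∈ s, |x i| ≤ 1} := by
      ext x; simp [mem_ball_iff]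
    rw [this]
    exact isClosed_iInter fun s => isClosed_le (by fun_prop) continuous_const
  refine (isCompact_univ_pi (fun _ : κ => isCompact_Icc (a := (-1 : ℝ)) (b := 1))).of_isClosed_subset
    hc ?_
  intro x hx i _
  have := mem_ball_iff.1 hx {i}
  simpa using abs_le.1 (by simpa using this)

instance instCompactSpaceBall (κ : Type u) : CompactSpace (ball κ) :=
  isCompact_iff_compactSpace.1 (isCompact_ball κ)

instance instCompactSpacePosBall (κ : Type u) : CompactSpace (posBall κ) := by
  refine isCompact_iff_compactSpace.1 ((isCompact_ball κ).inter_right ?_)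
  have : {x : κ → ℝ | ∀ i, 0 ≤ x i} = ⋂ i, {x | 0 ≤ x i} := by ext; simp
  change IsClosed {x : κ → ℝ | ∀ i, 0 ≤ x i}
  rw [this]
  exact isClosed_iInter fun i => isClosed_le continuous_const (continuous_apply i)

theorem gFun_mem {r : ℕ → ℝ} (hr : IsDigitSequence r) {κ : Type u} (p : LSpace r κ) :
    gFun r p ∈ posBall κ := by
  obtain ⟨hpos, hsum, -⟩ := hr
  have hterm : ∀ (i : κ) (m : ℕ), 0 ≤ (if (p.2 m (p.1.1 m)).1 i then r m else 0) := by
    intro i m; split_ifs <;> simp [(hpos m).le]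
  have hnn : ∀ i, 0 ≤ gFun r p i := fun i => tsum_nonneg (hterm i)
  have hsm : ∀ i : κ, Summable fun m => if (p.2 m (p.1.1 m)).1 i then r m else 0 := by
    intro i
    refine Summable.of_nonneg_of_le (hterm i) (fun m => ?_) hsum
    split_ifs <;> simp [(hpos m).le]
  refine ⟨mem_ball_iff.2 fun s => ?_, hnn⟩
  simp only [abs_of_nonneg (hnn _)]
  unfold gFun
  rw [← Summable.tsum_finsetSum (fun i _ => hsm i)]
  refine le_trans (Summable.tsum_le_tsum (fun m => ?_) (summable_sum fun i _ => hsm i) p.1.2.1)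
    p.1.2.2
  rw [← Finset.sum_filter, Finset.sum_const, nsmul_eq_mul, mul_comm]
  refine mul_le_mul_of_nonneg_left ?_ (hpos m).le
  have h1 := (p.2 m (p.1.1 m)).2
  have h2 : ((s.filter fun i => (p.2 m (p.1.1 m)).1 i = true : Finset κ) : Set κ).encard
      ≤ (p.1.1 m : ℕ∞) :=
    (encard_le_encard (fun i hi => by simpa using (Finset.mem_filter.1 hi).2)).trans h1
  rw [encard_coe_eq_coe_finsetCard] at h2
  exact_mod_cast h2

theorem continuous_gFun {r : ℕ → ℝ} (hr : IsDigitSequence r) (κ : Type u) :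
    Continuous (gFun r : LSpace r κ → κ → ℝ) := by
  obtain ⟨hpos, hsum, -⟩ := hr
  refine continuous_pi fun i => ?_
  refine continuous_tsum (u := r) (fun m => ?_) hsum (fun m p => ?_)
  · have h1 : Continuous fun p : LSpace r κ => (p.2 m (p.1.1 m)).1 i := by
      refine continuous_iff_continuousAt.2 fun p₀ => ?_
      have hz : Continuous fun p : LSpace r κ => p.1.1 m :=
        (continuous_apply m).comp (continuous_subtype_val.comp continuous_fst)
      have hev : ∀ᶠ p in nhds p₀, p.1.1 m = p₀.1.1 m :=
        hz.continuousAt.eventually_mem (s := {p₀.1.1 m}) (by simp [nhds_discrete])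
      have hc : Continuous fun p : LSpace r κ => (p.2 m (p₀.1.1 m)).1 i :=
        (continuous_apply i).comp (continuous_subtype_val.comp
          ((continuous_apply _).comp ((continuous_apply m).comp continuous_snd)))
      refine hc.continuousAt.congr (hev.mono fun p hp => ?_)
      change (p.2 m (p₀.1.1 m)).1 i = (p.2 m (p.1.1 m)).1 i
      rw [hp]
    exact (continuous_of_discreteTopology (f := fun b : Bool => if b then r m else 0)).comp h1
  · split_ifs <;> simp [abs_of_pos (hpos m), (hpos m).le]

/-- The map `g : L → B⁺(κ)`. -/
noncomputable def gMap {r : ℕ → ℝ} (hr : IsDigitSequence r) (κ : Type u) :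
    C(LSpace r κ, posBall κ) where
  toFun p := ⟨gFun r p, gFun_mem hr p⟩
  continuous_toFun := (continuous_gFun hr κ).subtype_mk _

theorem diff_mem {κ : Type u} (e : κ ≃ κ × Bool) (x : posBall κ) :
    (fun i => x.1 (e.symm (i, false)) - x.1 (e.symm (i, true))) ∈ ball κ := by
  refine mem_ball_iff.2 fun s => ?_
  have h := mem_ball_iff.1 x.2.1 ((s ×ˢ (Finset.univ : Finset Bool)).map e.symm.toEmbedding)
  rw [Finset.sum_map, Finset.sum_product] at h
  refine le_trans (Finset.sum_le_sum fun i _ => ?_) h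
  simp only [Fintype.sum_bool, Equiv.coe_toEmbedding]
  rw [add_comm]
  exact abs_sub _ _

/-- The surjection `B⁺(κ) ≅ B⁺(κ × {0,1}) → B(κ)`, `x ↦ (x_{(i,0)} - x_{(i,1)})_i`, where the
coordinates are relabelled by a bijection `e : κ ≃ κ × {0,1}`. -/
def diffMap {κ : Type u} (e : κ ≃ κ × Bool) : C(posBall κ, ball κ) where
  toFun x := ⟨fun i => x.1 (e.symm (i, false)) - x.1 (e.symm (i, true)), diff_mem e x⟩
  continuous_toFun := Continuous.subtype_mk (continuous_pi fun i =>
    ((continuous_apply (e.symm (i, false))).comp continuous_subtype_val).sub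
      ((continuous_apply (e.symm (i, true))).comp continuous_subtype_val)) _

/-- `u : X → Y` admits an averaging operator: a bounded linear operator `T : C(X) → C(Y)` with
`T (φ ∘ u) = φ` for all `φ ∈ C(Y)`. (For compact spaces the topology of `C(X, 𝕜)` is that of the
supremum norm.) -/
def HasAveragingOperator (𝕜 : Type*) [RCLike 𝕜] {X Y : Type*} [TopologicalSpace X]
    [CompactSpace X] [TopologicalSpace Y] [CompactSpace Y] (u : C(X, Y)) : Prop :=
  ∃ T : C(X, 𝕜) →L[𝕜] C(Y, 𝕜), ∀ φ : C(Y, 𝕜), T (φ.comp u) = φ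

/-! The obstruction to averaging is a splitting property. Suppose each point `y` of a set `D` is a
limit of points of `D` with fibres inside a clopen set `E`, and of points with fibres outside `E`.
For a bump `ψ` at `y`, an averaging operator `T` gives the two pieces of `ψ ∘ u` on `E` and `Eᶜ`
values at `y` with sum 1, so one value has modulus at least 1/2. Adding a unimodular multiple of
that piece and moving to a nearby point whose fibre misses it gains 1/4 without raising the norm
above 1. Iteration contradicts boundedness (`not_hasAveragingOperator_of_clopen_splitting`).

For `g`, take `D` to be the nonnegative finitely supported points of sum less than 1, with support
in `F`, and `E = excessSet r F M`. A single new coordinate larger than the tail of `r` beyond `M`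
must use a digit `m < M` outside `F`, which forces `E` (`mem_excessSet_of_tail_lt`). Filling the sum
almost up to 1 by tiny new coordinates forces `Eᶜ`: these carry no digit `m < M`, and an unused unit
of `z m` would waste mass `r m` (`notMem_excessSet_of_small`). Both arguments survive passage to
differences, since near total mass 1 almost no cancellation is possible. -/

/-! ### Clopen splitting excludes averaging operators. -/

section Averaging

variable {𝕜 : Type*} [RCLike 𝕜] {X Y : Type*} [TopologicalSpace X] [TopologicalSpace Y]

/-- The function `1_E · (ψ ∘ u)`, for a clopen set `E`. -/
noncomputable def clopenBump (𝕜 : Type*) [RCLike 𝕜] (u : C(X, Y)) {E : Set X} (hE : IsClopen E)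
    (ψ : C(Y, ℝ)) : C(X, 𝕜) where
  toFun := E.indicator fun x => (ψ (u x) : 𝕜)
  continuous_toFun := by
    refine Continuous.indicator (fun a ha => ?_) (by fun_prop)
    simp [hE.frontier_eq] at ha

theorem clopenBump_add_compl (u : C(X, Y)) {E : Set X} (hE : IsClopen E) (ψ : C(Y, ℝ)) :
    clopenBump 𝕜 u hE ψ + clopenBump 𝕜 u hE.compl ψ =
      (ContinuousMap.mk (fun y => (ψ y : 𝕜)) (by fun_prop) : C(Y, 𝕜)).comp u := by
  ext x
  exact congrFun (indicator_self_add_compl E fun x => (ψ (u x) : 𝕜)) x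

/-- If a function vanishes over a neighbourhood of `y` and the bump `1_E · (ψ ∘ u)` carries mass at
`y`, then adding a multiple of the bump increases the value of the operator at points near `y`
whose fibre avoids `E`. -/
theorem exists_gain_of_clopenBump [CompactSpace X] [T2Space Y] (u : C(X, Y))
    (T : C(X, 𝕜) →L[𝕜] C(Y, 𝕜)) {D : Set Y} {y : Y} {f : C(X, 𝕜)} (hf : ‖f‖ ≤ 1) {V : Set Y} (hV : IsOpen V) (hyV : y ∈ V)
    (hfV : ∀ x, u x ∈ V → f x = 0) {E : Set X} (hE : IsClopen E) (ψ : C(Y, ℝ))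
    (hψ : ∀ z, ψ z ∈ Icc (0 : ℝ) 1) (hψV : ∀ z, z ∉ V → ψ z = 0)
    (hy : y ∈ closure {y' ∈ D | u ⁻¹' {y'} ⊆ Eᶜ})
    (hmass : 1 / 2 ≤ ‖T (clopenBump 𝕜 u hE ψ) y‖) :
    ∃ y' ∈ D, ∃ f' : C(X, 𝕜), ‖f'‖ ≤ 1 ∧ (∃ V', IsOpen V' ∧ y' ∈ V' ∧ ∀ x, u x ∈ V' → f' x = 0) ∧
      RCLike.re (T f y) + 1 / 4 ≤ RCLike.re (T f' y') := by
  set b := clopenBump 𝕜 u hE ψ with hb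
  have hbx : ∀ x, b x = E.indicator (fun x => (ψ (u x) : 𝕜)) x := fun x => rfl
  have hb1 : ∀ x, ‖b x‖ ≤ 1 := fun x => by
    rw [hbx]
    by_cases hx : x ∈ E
    · rw [indicator_of_mem hx, RCLike.norm_ofReal, abs_of_nonneg (hψ _).1]
      exact (hψ _).2
    · simp [indicator_of_notMem hx]
  obtain ⟨c, hc, hcv⟩ := RCLike.exists_norm_eq_mul_self (T b y)
  have hcont : Continuous fun z => RCLike.re (T (f + c • b) z) :=
    RCLike.continuous_re.comp (T (f + c • b)).continuous
  have hval : RCLike.re (T f y) + 1 / 2 ≤ RCLike.re (T (f + c • b) y) := by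
    have h1 : RCLike.re (c * T b y) = ‖T b y‖ := by rw [← hcv, RCLike.ofReal_re]
    simp only [map_add, map_smul, ContinuousMap.add_apply, ContinuousMap.smul_apply, smul_eq_mul,
      h1]
    linarith
  have hopen : IsOpen ({z | RCLike.re (T f y) + 1 / 4 < RCLike.re (T (f + c • b) z)} ∩ V) :=
    (isOpen_lt continuous_const hcont).inter hV
  obtain ⟨y', ⟨hy'1, hy'V⟩, hy'D, hy'E⟩ :=
    mem_closure_iff.1 hy _ hopen ⟨by simp only [mem_ofPred_eq]; linarith, hyV⟩
  -- The norm stays at most 1 because `f` vanishes over `V` and `b` vanishes off it. The new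
  -- neighbourhood removes the compact image of `E`.
  refine ⟨y', hy'D, f + c • b, ?_, ⟨V ∩ (u '' E)ᶜ, ?_, ⟨hy'V, ?_⟩, ?_⟩, hy'1.le⟩
  · refine (ContinuousMap.norm_le _ zero_le_one).2 fun x => ?_
    by_cases hx : u x ∈ V
    · simpa [hfV x hx, hc] using hb1 x
    · have : b x = 0 := by
        rw [hbx, indicator_apply_eq_zero]
        intro _
        simp [hψV _ hx]
      simpa [this] using (f.norm_coe_le_norm x).trans hf
  · exact hV.inter (u.continuous.isClosedMap _ hE.isClosed).isOpen_compl
  · rintro ⟨x, hxE, hx⟩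
    exact hy'E hx hxE
  · rintro x ⟨hxV, hxE⟩
    have : b x = 0 := by
      rw [hbx, indicator_of_notMem]
      exact fun h => hxE ⟨x, h, rfl⟩
    simp [hfV x hxV, this]

/-- If every point of a nonempty set `D` is a limit of points of `D` with fibres inside a clopen set
`E`, and also of points of `D` with fibres outside `E`, then there is no averaging operator. -/
theorem not_hasAveragingOperator_of_clopen_splitting [CompactSpace X] [CompactSpace Y]
    [T2Space Y] (u : C(X, Y)) {D : Set Y} (hD : D.Nonempty)
    (hsplit : ∀ y ∈ D, ∃ E : Set X, IsClopen E ∧ y ∈ closure {y' ∈ D | u ⁻¹' {y'} ⊆ E} ∧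
      y ∈ closure {y' ∈ D | u ⁻¹' {y'} ⊆ Eᶜ}) :
    ¬ HasAveragingOperator 𝕜 u := by
  rintro ⟨T, hT⟩
  -- From any admissible pair `(y, f)`, `n` further gains of 1/4 remain possible.
  have key : ∀ n : ℕ, ∀ y ∈ D, ∀ f : C(X, 𝕜), ‖f‖ ≤ 1 →
      (∃ V, IsOpen V ∧ y ∈ V ∧ ∀ x, u x ∈ V → f x = 0) →
      RCLike.re (T f y) + n * (1 / 4) ≤ ‖T‖ := by
    intro n
    induction n with
    | zero =>
      intro y _ f hf _
      have h1 : ‖T f y‖ ≤ ‖T‖ := ((T f).norm_coe_le_norm y).trans (T.unit_le_opNorm f hf)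
      simpa using (RCLike.re_le_norm _).trans h1
    | succ n ih =>
      rintro y hy f hf ⟨V, hV, hyV, hfV⟩
      obtain ⟨E, hE, hcl, hcl'⟩ := hsplit y hy
      obtain ⟨ψ, hψ0, hψ1, hψ⟩ := exists_continuous_zero_one_of_isClosed hV.isClosed_compl
        (isClosed_singleton (x := y)) (by simpa using hyV)
      have hsum : T (clopenBump 𝕜 u hE ψ) y + T (clopenBump 𝕜 u hE.compl ψ) y = 1 := by
        rw [← ContinuousMap.add_apply, ← map_add, clopenBump_add_compl, hT]
        simp [hψ1 rfl]
      have hstep : ∃ y' ∈ D, ∃ f' : C(X, 𝕜), ‖f'‖ ≤ 1 ∧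
          (∃ V', IsOpen V' ∧ y' ∈ V' ∧ ∀ x, u x ∈ V' → f' x = 0) ∧
          RCLike.re (T f y) + 1 / 4 ≤ RCLike.re (T f' y') := by
        by_cases hm : 1 / 2 ≤ ‖T (clopenBump 𝕜 u hE ψ) y‖
        · exact exists_gain_of_clopenBump u T hf hV hyV hfV hE ψ hψ (fun z hz => hψ0 hz) hcl' hm
        · refine exists_gain_of_clopenBump u T hf hV hyV hfV hE.compl ψ hψ (fun z hz => hψ0 hz)
            (by rwa [compl_compl]) ?_
          have h2 := norm_add_le (T (clopenBump 𝕜 u hE ψ) y) (T (clopenBump 𝕜 u hE.compl ψ) y)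
          rw [hsum, norm_one] at h2
          linarith
      obtain ⟨y', hy', f', hf', hV', hgain⟩ := hstep
      have := ih y' hy' f' hf' hV'
      push_cast
      linarith
  obtain ⟨y, hy⟩ := hD
  obtain ⟨n, hn⟩ := exists_nat_gt (‖T‖ * 4)
  have := key n y hy 0 (by simp) ⟨univ, isOpen_univ, mem_univ _, fun _ _ => rfl⟩
  simp only [map_zero, ContinuousMap.zero_apply] at this
  linarith

end Averaging

/-! ### Continuous surjections from `A(κ)^ℕ` onto `L`. -/

section Existence

theorem mem_zSpace_iff {r : ℕ → ℝ} (hpos : ∀ n, 0 < r n) {z : ℕ → ℕ} :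
    z ∈ zSpace r ↔ ∀ s : Finset ℕ, ∑ n ∈ s, r n * (z n : ℝ) ≤ 1 := by
  have h0 : ∀ n, 0 ≤ r n * (z n : ℝ) := fun n => mul_nonneg (hpos n).le (Nat.cast_nonneg _)
  constructor
  · rintro ⟨hs, h1⟩ s
    exact (hs.sum_le_tsum s fun i _ => h0 i).trans h1
  · intro h
    exact ⟨summable_of_sum_le h0 h, Real.tsum_le_of_sum_le h0 h⟩

theorem isCompact_zSpace {r : ℕ → ℝ} (hpos : ∀ n, 0 < r n) : IsCompact (zSpace r) := by
  have hc : IsClosed (zSpace r) := by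
    have : zSpace r = ⋂ s : Finset ℕ, {z | ∑ n ∈ s, r n * (z n : ℝ) ≤ 1} := by
      ext z; simp [mem_zSpace_iff hpos]
    rw [this]
    refine isClosed_iInter fun s => isClosed_le (continuous_finsetSum _ fun n _ => ?_)
      continuous_const
    exact continuous_const.mul (continuous_of_discreteTopology.comp (continuous_apply n))
  refine (isCompact_univ_pi fun n : ℕ => (finite_Iic ⌊1 / r n⌋₊).isCompact).of_isClosed_subset
    hc fun z hz n _ => ?_
  have h1 := (mem_zSpace_iff hpos).1 hz {n}
  rw [Finset.sum_singleton] at h1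
  exact Nat.le_floor (by rw [le_div_iff₀ (hpos n)]; linarith)

variable {κ : Type u} [TopologicalSpace κ] [DiscreteTopology κ]

theorem isClopen_singleton_coe (i : κ) : IsClopen ({(i : OnePoint κ)} : Set (OnePoint κ)) := by
  refine ⟨isClosed_singleton, ?_⟩
  have h := (OnePoint.isOpen_image_coe (s := ({i} : Set κ))).2 (isOpen_discrete _)
  simpa using h

/-- `Z` is compact metrizable, hence an image of the Cantor set, onto which `A(κ)^ℕ` maps by testing
every coordinate against one isolated point. -/
theorem exists_surjective_zSpace [Nonempty κ] {r : ℕ → ℝ} (hpos : ∀ n, 0 < r n) :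
    ∃ f : C(ℕ → OnePoint κ, zSpace r), Function.Surjective f := by
  classical
  have : CompactSpace (zSpace r) := isCompact_iff_compactSpace.1 (isCompact_zSpace hpos)
  have : Nonempty (zSpace r) := ⟨⟨0, (mem_zSpace_iff hpos).2 (by simp)⟩⟩
  let : MetricSpace (zSpace r) := TopologicalSpace.metrizableSpaceMetric _
  obtain ⟨f, hf, hfs⟩ := exists_nat_bool_continuous_surjective_of_compact (zSpace r)
  obtain ⟨i⟩ := ‹Nonempty κ›
  have hb : Continuous fun a : OnePoint κ => decide (a = (i : OnePoint κ)) :=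
    continuous_bool_rng true |>.2 (by
      simpa [preimage, ofPred_eq_eq_singleton] using isClopen_singleton_coe i)
  refine ⟨⟨fun a => f fun n => decide (a n = (i : OnePoint κ)),
    hf.comp (continuous_pi fun n => hb.comp (continuous_apply n))⟩, fun z => ?_⟩
  obtain ⟨t, rfl⟩ := hfs z
  refine ⟨fun n => if t n then (i : OnePoint κ) else OnePoint.infty, congrArg f (funext fun n => ?_)⟩
  cases h : t n <;> simp [h]

/-- The first `n` coordinates list the support; `∞` serves as padding for smaller supports. -/
theorem exists_surjective_sigmaSpace (n : ℕ) :
    ∃ f : C(ℕ → OnePoint κ, sigmaSpace n κ), Function.Surjective f := by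
  classical
  have hmem : ∀ a : ℕ → OnePoint κ,
      (fun i : κ => decide (∃ k < n, a k = (i : OnePoint κ))) ∈ sigmaSpace n κ := by
    intro a
    have hinj := (OnePoint.coe_injective (X := κ)).encard_image
      {i | decide (∃ k < n, a k = (i : OnePoint κ)) = true}
    change encard _ ≤ _
    rw [← hinj]
    refine (encard_le_encard (t := ((Finset.range n).image a : Set (OnePoint κ))) ?_).trans ?_
    · rintro _ ⟨i, hi, rfl⟩
      simpa using hi
    · rw [encard_coe_eq_coe_finsetCard]
      exact_mod_cast Finset.card_image_le.trans (Finset.card_range n).le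
  refine ⟨⟨fun a => ⟨_, hmem a⟩, Continuous.subtype_mk (continuous_pi fun i => ?_) _⟩, ?_⟩
  · refine (continuous_bool_rng true).2 ?_
    have : (fun a : ℕ → OnePoint κ => decide (∃ k < n, a k = (i : OnePoint κ))) ⁻¹' {true} =
        ⋃ k ∈ Finset.range n, (fun a : ℕ → OnePoint κ => a k) ⁻¹' {(i : OnePoint κ)} := by
      ext a; simp
    rw [this]
    exact isClopen_biUnion_finset fun k _ =>
      (isClopen_singleton_coe i).preimage (continuous_apply k)
  · rintro ⟨x, hx⟩
    have hx' : {i | x i = true}.encard ≤ n := hx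
    have hfin : {i | x i = true}.Finite := finite_of_encard_le_coe hx'
    set s := hfin.toFinset with hs
    have hcard : s.card ≤ n := by
      rw [hfin.encard_eq_coe_toFinset_card] at hx'
      exact_mod_cast hx'
    refine ⟨fun k => if h : k < s.card then ((s.equivFin.symm ⟨k, h⟩ : κ) : OnePoint κ)
      else OnePoint.infty, Subtype.ext (funext fun i => ?_)⟩
    rw [Bool.eq_iff_iff]
    simp only [ContinuousMap.coe_mk, decide_eq_true_eq]
    constructor
    · rintro ⟨k, -, hk⟩
      split_ifs at hk with h
      · have := (s.equivFin.symm ⟨k, h⟩).2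
        rw [OnePoint.coe_injective hk] at this
        simpa [hs] using this
      · exact absurd hk (OnePoint.infty_ne_coe i)
    · intro hi
      have his : i ∈ s := by simpa [hs] using hi
      refine ⟨s.equivFin ⟨i, his⟩, (s.equivFin ⟨i, his⟩).2.trans_le hcard, ?_⟩
      simp

theorem exists_surjective_LSpace [Nonempty κ] {r : ℕ → ℝ} (hpos : ∀ n, 0 < r n) :
    ∃ h : C(ℕ → OnePoint κ, LSpace r κ), Function.Surjective h := by
  obtain ⟨f, hf⟩ := exists_surjective_zSpace (κ := κ) hpos
  choose g hg using fun n => exists_surjective_sigmaSpace (κ := κ) n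
  -- Each factor gets its own infinite block of coordinates: `none` for `Z`, `some (m, n)` for the
  -- factor of `x[m,n]`.
  obtain ⟨ε⟩ := nonempty_equiv_of_countable (α := ℕ) (β := Option (ℕ × ℕ) × ℕ)
  refine ⟨⟨fun a => (f fun k => a (ε.symm (none, k)),
    fun m n => g n fun k => a (ε.symm (some (m, n), k))), by fun_prop⟩, ?_⟩
  rintro ⟨z, x⟩
  obtain ⟨a, rfl⟩ := hf z
  choose b hb using fun m n => hg n (x m n)
  refine ⟨fun k => (ε k).1.elim (a (ε k).2) fun mn => b mn.1 mn.2 (ε k).2, ?_⟩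
  refine Prod.ext (congrArg f ?_) (funext fun m => funext fun n => ?_)
  · ext k; simp
  · exact (congrArg (g n) (by ext k; simp)).trans (hb m n)

end Existence

/-! ### Surjectivity of `g` and of the difference map. -/

section Surjectivity

variable {κ : Type u}

/-- Expand each `x i` in digits and let `z n` count the coordinates whose `n`-th digit is one.
Double counting gives `∑ r n * z n ≤ ∑ x i ≤ 1`. -/
theorem gMap_surjective {r : ℕ → ℝ} (hr : IsDigitSequence r) :
    Function.Surjective (gMap hr κ) := by
  classical
  obtain ⟨hpos, hsum, hrange⟩ := id hr
  rintro ⟨x, hx, hx0⟩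
  have hxs : ∀ s : Finset κ, ∑ i ∈ s, x i ≤ 1 := fun s => by
    simpa only [abs_of_nonneg (hx0 _)] using mem_ball_iff.1 hx s
  have hdig : ∀ i, ∃ t : ℕ → Bool, ∑' n, (if t n then r n else 0) = x i := fun i => by
    have : x i ∈ Icc (0 : ℝ) 1 := ⟨hx0 i, by simpa using hxs {i}⟩
    rwa [← hrange] at this
  choose t ht using hdig
  have h0 : ∀ i n, 0 ≤ (if t i n then r n else 0) := fun i n => by
    split_ifs <;> simp [(hpos n).le]
  have hts : ∀ i, Summable fun n => if t i n then r n else 0 := fun i =>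
    Summable.of_nonneg_of_le (h0 i) (fun n => by split_ifs <;> simp [(hpos n).le]) hsum
  have hle : ∀ i (s : Finset ℕ), ∑ n ∈ s, (if t i n then r n else 0) ≤ x i := fun i s => by
    rw [← ht i]
    exact (hts i).sum_le_tsum s fun n _ => h0 i n
  have hfin : ∀ n, {i | t i n = true}.Finite := fun n => by
    have hsx : Summable x := by simpa only [abs_of_nonneg (hx0 _)] using hx.1
    have hev := hsx.tendsto_cofinite_zero.eventually (gt_mem_nhds (hpos n))
    rw [Filter.eventually_cofinite] at hev
    -- A digit one in place `n` forces `r n ≤ x i`, which happens for finitely many `i`.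
    refine hev.subset fun i hi => ?_
    have hi' : t i n = true := hi
    simpa [hi'] using hle i {n}
  let z : ℕ → ℕ := fun n => (hfin n).toFinset.card
  have hz : z ∈ zSpace r := by
    refine (mem_zSpace_iff hpos).2 fun s => ?_
    set A := s.biUnion fun n => (hfin n).toFinset with hA
    have hcard : ∀ n ∈ s, r n * (z n : ℝ) = ∑ i ∈ A, if t i n then r n else 0 := by
      intro n hn
      have hfilter : (hfin n).toFinset = A.filter fun i => t i n = true := by
        ext i
        simp only [Finite.mem_toFinset, mem_ofPred_eq, Finset.mem_filter, hA, Finset.mem_biUnion]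
        exact ⟨fun h => ⟨⟨n, hn, h⟩, h⟩, fun h => h.2⟩
      rw [← Finset.sum_filter, Finset.sum_const, nsmul_eq_mul, mul_comm, ← hfilter]
    rw [Finset.sum_congr rfl hcard, Finset.sum_comm]
    exact (Finset.sum_le_sum fun i _ => hle i s).trans (hxs A)
  refine ⟨(⟨z, hz⟩, fun m n => ⟨fun i => decide (n = z m) && t i m, ?_⟩),
    Subtype.ext (funext fun i => ?_)⟩
  · change encard _ ≤ _
    by_cases hn : n = z m
    · simp only [hn, decide_true, Bool.true_and]
      rw [(hfin m).encard_eq_coe_toFinset_card]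
    · simp [hn]
  · change gFun r _ i = x i
    rw [← ht i]
    simp [gFun]

/-- The positive and negative parts of `y` give a preimage with the same total mass. -/
theorem diffMap_surjective (e : κ ≃ κ × Bool) : Function.Surjective (diffMap e) := by
  rintro ⟨y, hy⟩
  let x : κ → ℝ := fun j => if (e j).2 then (y (e j).1)⁻ else (y (e j).1)⁺
  have hx0 : ∀ j, 0 ≤ x j := fun j => by
    simp only [x]
    split_ifs
    exacts [negPart_nonneg _, posPart_nonneg _]
  have hx : x ∈ ball κ := by
    classical
    refine mem_ball_iff.2 fun s => ?_
    simp only [abs_of_nonneg (hx0 _)]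
    calc ∑ j ∈ s, x j ≤ ∑ j ∈ ((s.image fun j => (e j).1) ×ˢ Finset.univ).map
          e.symm.toEmbedding, x j := by
          refine Finset.sum_le_sum_of_subset_of_nonneg (fun j hj => ?_) fun j _ _ => hx0 j
          rw [Finset.mem_map_equiv]
          simpa using ⟨j, hj, rfl⟩
      _ = ∑ i ∈ s.image fun j => (e j).1, |y i| := by
          rw [Finset.sum_map, Finset.sum_product]
          refine Finset.sum_congr rfl fun i _ => ?_
          rw [← posPart_add_negPart (y i), add_comm]
          simp [x]
      _ ≤ 1 := mem_ball_iff.1 hy _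
  refine ⟨⟨x, hx, hx0⟩, Subtype.ext (funext fun i => ?_)⟩
  change x (e.symm (i, false)) - x (e.symm (i, true)) = y i
  simp [x, posPart_sub_negPart]

end Surjectivity

/-! ### The splitting property for maps controlled by `g`. -/

section Splitting

variable {κ : Type u} {r : ℕ → ℝ}

/-- The digit `x[m, z m]_i` of a point `p = (z, x)` of `L`. -/
def digit (p : LSpace r κ) (m : ℕ) (i : κ) : Bool := (p.2 m (p.1.1 m)).1 i

theorem continuous_zCoord (m : ℕ) : Continuous fun p : LSpace r κ => p.1.1 m :=
  (continuous_apply m).comp (continuous_subtype_val.comp continuous_fst)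

theorem continuous_digit (m : ℕ) (i : κ) : Continuous fun p : LSpace r κ => digit p m i := by
  refine continuous_iff_continuousAt.2 fun p₀ => ?_
  have hev : ∀ᶠ p : LSpace r κ in nhds p₀, p.1.1 m = p₀.1.1 m :=
    (continuous_zCoord m).continuousAt.eventually_mem (s := {p₀.1.1 m}) (by simp [nhds_discrete])
  have hc : Continuous fun p : LSpace r κ => (p.2 m (p₀.1.1 m)).1 i :=
    (continuous_apply i).comp (continuous_subtype_val.comp
      ((continuous_apply _).comp ((continuous_apply m).comp continuous_snd)))
  refine hc.continuousAt.congr (hev.mono fun p hp => ?_)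
  change (p.2 m (p₀.1.1 m)).1 i = (p.2 m (p.1.1 m)).1 i
  rw [hp]

/-- The number of coordinates in `S` at which the `m`-th digit of `p` is one. -/
def digitCount (p : LSpace r κ) (m : ℕ) (S : Finset κ) : ℕ := ∑ i ∈ S, if digit p m i then 1 else 0

theorem digitCount_le (p : LSpace r κ) (m : ℕ) (S : Finset κ) : digitCount p m S ≤ p.1.1 m := by
  have h1 : {i | digit p m i = true}.encard ≤ (p.1.1 m : ℕ∞) := (p.2 m (p.1.1 m)).2
  have h2 : ((S.filter fun i => digit p m i = true : Finset κ) : Set κ).encard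
      ≤ (p.1.1 m : ℕ∞) :=
    (encard_le_encard (fun i hi => by simpa using (Finset.mem_filter.1 hi).2)).trans h1
  rw [encard_coe_eq_coe_finsetCard] at h2
  rw [digitCount, ← Finset.card_filter]
  exact_mod_cast h2

/-- The points `(z, x)` of `L` such that, for some `m < M`, the number `z m` exceeds the count of
`m`-th digits on `F`. -/
def excessSet (r : ℕ → ℝ) (F : Finset κ) (M : ℕ) : Set (LSpace r κ) :=
  {p | ∃ m < M, digitCount p m F < p.1.1 m}

theorem isClopen_excessSet (F : Finset κ) (M : ℕ) : IsClopen (excessSet r F M) := by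
  have : excessSet r F M = ⋃ m ∈ Finset.range M,
      (fun p : LSpace r κ => (digitCount p m F, p.1.1 m)) ⁻¹' {q : ℕ × ℕ | q.1 < q.2} := by
    ext p; simp [excessSet]
  rw [this]
  refine isClopen_biUnion_finset fun m _ => (isClopen_discrete _).preimage
    (Continuous.prodMk (continuous_finsetSum _ fun i _ => ?_) (continuous_zCoord m))
  exact (continuous_of_discreteTopology (f := fun b : Bool => if b then 1 else 0)).comp
    (continuous_digit m i)

theorem summable_digit (hr : IsDigitSequence r) (p : LSpace r κ) (i : κ) :
    Summable fun m => if digit p m i then r m else 0 :=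
  Summable.of_nonneg_of_le (fun m => by split_ifs <;> simp [(hr.1 m).le])
    (fun m => by split_ifs <;> simp [(hr.1 m).le]) hr.2.1

theorem le_gFun_of_digit (hr : IsDigitSequence r) {p : LSpace r κ} {m : ℕ} {i : κ}
    (h : digit p m i = true) : r m ≤ gFun r p i := by
  have := (summable_digit hr p i).le_tsum m fun n _ => by split_ifs <;> simp [(hr.1 n).le]
  rwa [if_pos h] at this

/-- Digits beyond `M` sum to at most the tail, so some digit `m < M` at `i` is one; it counts
towards `z m` but not on `F`. -/
theorem mem_excessSet_of_tail_lt (hr : IsDigitSequence r) {F : Finset κ} {M : ℕ}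
    {p : LSpace r κ} {i : κ} (hi : i ∉ F) (h : ∑' n, r (n + M) < gFun r p i) :
    p ∈ excessSet r F M := by
  classical
  obtain ⟨m, hm, hd⟩ : ∃ m < M, digit p m i = true := by
    by_contra! hcon
    have hs := summable_digit hr p i
    refine h.not_ge ?_
    change ∑' m, (if digit p m i then r m else 0) ≤ _
    rw [← hs.sum_add_tsum_nat_add M, Finset.sum_eq_zero fun m hm => by
      simp [hcon m (Finset.mem_range.1 hm)], zero_add]
    exact ((summable_nat_add_iff M).2 hs).tsum_le_tsum
      (fun n => by split_ifs <;> simp [(hr.1 _).le]) ((summable_nat_add_iff M).2 hr.2.1)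
  refine ⟨m, hm, ?_⟩
  have := digitCount_le p m (insert i F)
  rw [digitCount, Finset.sum_insert hi, if_pos hd] at this
  change 1 + digitCount p m F ≤ _ at this
  omega

/-- By smallness all digits `m < M` live on `F`. An excess at `m₀` leaves a unit of `z m₀` unused,
so the sum over `S` is at most `1 - r m₀`. -/
theorem notMem_excessSet_of_small (hr : IsDigitSequence r) {F : Finset κ} {M : ℕ}
    {p : LSpace r κ} (hsmall : ∀ j ∉ F, ∀ m < M, gFun r p j < r m) {S : Finset κ}
    (hS : ∀ m < M, 1 - r m < ∑ j ∈ S, gFun r p j) : p ∉ excessSet r F M := by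
  classical
  rintro ⟨m₀, hm₀, hlt⟩
  refine (hS m₀ hm₀).not_ge ?_
  have hcount : digitCount p m₀ S ≤ digitCount p m₀ F := by
    simp only [digitCount, ← Finset.card_filter]
    refine Finset.card_le_card fun j hj => ?_
    have hj' := (Finset.mem_filter.1 hj).2
    refine Finset.mem_filter.2 ⟨by_contra fun hjF => ?_, hj'⟩
    exact (hsmall j hjF m₀ hm₀).not_ge (le_gFun_of_digit hr hj')
  have hterm : ∀ m, ∑ j ∈ S, (if digit p m j then r m else 0) ≤
      r m * (p.1.1 m : ℝ) - if m = m₀ then r m₀ else 0 := by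
    intro m
    have heq : ∑ j ∈ S, (if digit p m j then r m else 0) = r m * (digitCount p m S : ℝ) := by
      rw [digitCount, Nat.cast_sum, Finset.mul_sum]
      exact Finset.sum_congr rfl fun j _ => by split_ifs <;> simp
    rw [heq]
    split_ifs with hm
    · subst hm
      have : (digitCount p m S : ℝ) + 1 ≤ p.1.1 m := by exact_mod_cast hcount.trans_lt hlt
      nlinarith [hr.1 m]
    · rw [sub_zero]
      exact mul_le_mul_of_nonneg_left (by exact_mod_cast digitCount_le p m S) (hr.1 m).le
  have hite : Summable fun m => if m = m₀ then r m₀ else 0 := (hasSum_ite_eq m₀ (r m₀)).summable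
  calc ∑ j ∈ S, gFun r p j = ∑' m, ∑ j ∈ S, (if digit p m j then r m else 0) :=
        (Summable.tsum_finsetSum fun j _ => summable_digit hr p j).symm
    _ ≤ ∑' m, (r m * (p.1.1 m : ℝ) - if m = m₀ then r m₀ else 0) :=
        (summable_sum fun j _ => summable_digit hr p j).tsum_le_tsum hterm (p.1.2.1.sub hite)
    _ = ∑' m, r m * (p.1.1 m : ℝ) - r m₀ := by
        rw [p.1.2.1.tsum_sub hite, tsum_ite_eq]
    _ ≤ 1 - r m₀ := sub_le_sub_right p.1.2.2 _

/-- Finitely supported nonnegative functions with sum less than one, `F` containing the support. -/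
structure IsInnerFinite (y : κ → ℝ) (F : Finset κ) : Prop where
  nonneg : ∀ i, 0 ≤ y i
  eq_zero : ∀ i ∉ F, y i = 0
  sum_lt : ∑ i ∈ F, y i < 1

theorem IsInnerFinite.mem_posBall {y : κ → ℝ} {F : Finset κ} (h : IsInnerFinite y F) :
    y ∈ posBall κ := by
  classical
  refine ⟨mem_ball_iff.2 fun S => ?_, h.nonneg⟩
  simp only [abs_of_nonneg (h.nonneg _)]
  calc ∑ i ∈ S, y i ≤ ∑ i ∈ S ∪ F, y i :=
        Finset.sum_le_sum_of_subset_of_nonneg Finset.subset_union_left fun i _ _ => h.nonneg i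
    _ = ∑ i ∈ F, y i :=
        (Finset.sum_subset Finset.subset_union_right fun i _ hi => h.eq_zero i hi).symm
    _ ≤ 1 := h.sum_lt.le

/-- An inner finite function can be changed to the constant `b` on `k` new coordinates, away from a
given finite set, as long as the sum stays less than one. -/
theorem IsInnerFinite.exists_extension [Infinite κ] [DecidableEq κ] {y : κ → ℝ} {F : Finset κ}
    (h : IsInnerFinite y F) (S : Finset κ) {k : ℕ} {b : ℝ} (hb : 0 ≤ b)
    (hsum : ∑ i ∈ F, y i + k * b < 1) :
    ∃ (y' : κ → ℝ) (G : Finset κ), IsInnerFinite y' (F ∪ G) ∧ G.card = k ∧ Disjoint F G ∧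
      (∀ i ∈ S, y' i = y i) ∧ (∀ i ∈ G, y' i = b) ∧ (∀ i ∉ F, y' i ≤ b) ∧
      ∑ i ∈ F ∪ G, y' i = ∑ i ∈ F, y i + k * b := by
  obtain ⟨G, hG, hGk⟩ := (F ∪ S).finite_toSet.infinite_compl.exists_subset_card_eq k
  have hGF : ∀ i ∈ G, i ∉ F := fun i hi hF => hG hi (by simp [hF])
  have hGS : ∀ i ∈ S, i ∉ G := fun i hi hg => hG hg (by simp [hi])
  have hdisj : Disjoint F G := Finset.disjoint_right.2 fun i hi => hGF i hi
  have hsum' : ∑ i ∈ F ∪ G, (if i ∈ G then b else y i) = ∑ i ∈ F, y i + k * b := by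
    rw [Finset.sum_union hdisj]
    congr 1
    · exact Finset.sum_congr rfl fun i hi => if_neg fun hg => hGF i hg hi
    · rw [Finset.sum_congr rfl fun i hi => if_pos hi, Finset.sum_const, hGk, nsmul_eq_mul]
  refine ⟨fun i => if i ∈ G then b else y i, G, ⟨fun i => ?_, fun i hi => ?_, ?_⟩, hGk, hdisj,
    fun i hi => if_neg (hGS i hi), fun i hi => if_pos hi, fun i hi => ?_, hsum'⟩
  · split_ifs
    exacts [hb, h.nonneg i]
  · rw [Finset.mem_union, not_or] at hi
    exact (if_neg hi.2).trans (h.eq_zero i hi.1)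
  · rwa [hsum']
  · dsimp only
    split_ifs
    exacts [le_rfl, (h.eq_zero i hi).trans_le hb]

theorem mem_closure_of_agree_on_finset {P : Set (κ → ℝ)} {y : P} {A : Set P}
    (h : ∀ S : Finset κ, ∃ y' ∈ A, ∀ i ∈ S, y'.1 i = y.1 i) : y ∈ closure A := by
  refine mem_closure_iff.2 fun O hO hy => ?_
  obtain ⟨W, hW, rfl⟩ := isOpen_induced_iff.1 hO
  obtain ⟨S, v, hv, hvW⟩ := isOpen_pi_iff.1 hW y.1 hy
  obtain ⟨y', hy', hagree⟩ := h S
  refine ⟨y', hvW fun i hi => ?_, hy'⟩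
  rw [hagree i hi]
  exact (hv i hi).2

/-- A map into a space of functions on `κ` which controls, and is controlled by, the map `g` up to a
finite-to-one reindexing `d` has no averaging operator. -/
theorem not_hasAveragingOperator_of_controls_gFun (𝕜 : Type*) [RCLike 𝕜] [Infinite κ]
    (hr : IsDigitSequence r) {X : Type*} [TopologicalSpace X] [CompactSpace X]
    {P : Set (κ → ℝ)} [CompactSpace P] (hP : posBall κ ⊆ P) (u : C(X, P)) (h : C(X, LSpace r κ))
    (d : κ → κ) (hd : ∀ F : Finset κ, (d ⁻¹' F).Finite)
    (hlower : ∀ x i, ∃ j, d j = i ∧ (u x).1 i ≤ gFun r (h x) j)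
    (hupper : ∀ x (S : Finset κ) j,
      gFun r (h x) j ≤ |(u x).1 (d j)| + (1 - ∑ i ∈ S, |(u x).1 i|))
    (hsum : ∀ x (S : Finset κ), ∃ S' : Finset κ,
      ∑ i ∈ S, |(u x).1 i| ≤ ∑ j ∈ S', gFun r (h x) j) :
    ¬ HasAveragingOperator 𝕜 u := by
  classical
  have hzero : IsInnerFinite (0 : κ → ℝ) ∅ := ⟨fun _ => le_rfl, fun _ _ => rfl, by simp⟩
  refine not_hasAveragingOperator_of_clopen_splitting u
    (D := {y | ∃ F, IsInnerFinite y.1 F}) ⟨⟨0, hP hzero.mem_posBall⟩, ∅, hzero⟩ ?_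
  rintro ⟨y, hyP⟩ ⟨F, hF⟩
  change IsInnerFinite y F at hF
  set s := 1 - ∑ i ∈ F, y i with hs
  have hs0 : 0 < s := sub_pos.2 hF.sum_lt
  obtain ⟨M, hM⟩ : ∃ M, ∑' n, r (n + M) < s / 2 :=
    ((tendsto_sum_nat_add r).eventually (gt_mem_nhds (half_pos hs0))).exists
  have hmem : ∀ {j}, j ∉ (hd F).toFinset ↔ d j ∉ F := by simp
  refine ⟨h ⁻¹' excessSet r (hd F).toFinset M,
    (isClopen_excessSet _ _).preimage h.continuous, ?_, ?_⟩
  · refine mem_closure_of_agree_on_finset fun S => ?_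
    -- One new coordinate of size `s / 2` beats the tail yet keeps the sum below 1.
    obtain ⟨y', G, hy', hG, hFG, hS, hyG, -, -⟩ :=
      hF.exists_extension S (k := 1) (half_pos hs0).le (by push_cast; linarith)
    refine ⟨⟨y', hP hy'.mem_posBall⟩, ⟨⟨_, hy'⟩, ?_⟩, hS⟩
    intro x hx
    have hx' : (u x).1 = y' := congrArg Subtype.val hx
    obtain ⟨i, rfl⟩ := Finset.card_eq_one.1 hG
    obtain ⟨j, hj, hle⟩ := hlower x i
    refine mem_excessSet_of_tail_lt hr (i := j) ?_ ?_
    · rw [hmem, hj]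
      exact Finset.disjoint_singleton_right.1 hFG
    · rw [hx', hyG i (Finset.mem_singleton_self i)] at hle
      exact hM.trans_le hle
  · refine mem_closure_of_agree_on_finset fun S => ?_
    -- `δ` is the mass left unfilled. The factor 2 covers a new coordinate below `δ` plus the slack
    -- `δ` in `hupper`.
    obtain ⟨δ, hδ0, hδs, hδ⟩ : ∃ δ : ℝ, 0 < δ ∧ δ < s ∧ ∀ m < M, 2 * δ < r m := by
      have h1 : ∀ᶠ δ : ℝ in nhdsWithin 0 (Ioi 0), δ < s :=
        (gt_mem_nhds hs0).filter_mono nhdsWithin_le_nhds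
      have h2 : ∀ᶠ δ : ℝ in nhdsWithin 0 (Ioi 0), ∀ m ∈ Finset.range M, δ < r m / 2 :=
        (Filter.eventually_all_finset _).2 fun m _ =>
          (gt_mem_nhds (half_pos (hr.1 m))).filter_mono nhdsWithin_le_nhds
      obtain ⟨δ, h0, h1, h2⟩ := (Filter.Eventually.and (self_mem_nhdsWithin (s := Ioi (0 : ℝ)))
        (h1.and h2)).exists
      refine ⟨δ, h0, h1, fun m hm => ?_⟩
      linarith [h2 m (Finset.mem_range.2 hm)]
    obtain ⟨k, hk⟩ := exists_nat_gt ((s - δ) / δ)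
    have hk0 : (0 : ℝ) < k := (div_pos (sub_pos.2 hδs) hδ0).trans hk
    have hkb : (k : ℝ) * ((s - δ) / k) = s - δ := mul_div_cancel₀ _ hk0.ne'
    have hbδ : (s - δ) / k < δ := by
      rw [div_lt_iff₀ hδ0] at hk
      rw [div_lt_iff₀ hk0]
      linarith
    obtain ⟨y', G, hy', -, -, hS, -, hyb, hy'sum⟩ :=
      hF.exists_extension S (k := k) (b := (s - δ) / k)
        (div_nonneg (sub_pos.2 hδs).le hk0.le) (by rw [hkb]; linarith)
    refine ⟨⟨y', hP hy'.mem_posBall⟩, ⟨⟨_, hy'⟩, ?_⟩, hS⟩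
    intro x hx
    have hx' : (u x).1 = y' := congrArg Subtype.val hx
    have habs : ∑ i ∈ F ∪ G, |(u x).1 i| = 1 - δ := by
      simp only [hx', abs_of_nonneg (hy'.nonneg _)]
      rw [hy'sum, hkb]
      linarith
    obtain ⟨S', hS'⟩ := hsum x (F ∪ G)
    refine notMem_excessSet_of_small hr (fun j hj m hm => ?_) (S := S') fun m hm => ?_
    · have h1 := hupper x (F ∪ G) j
      rw [habs, hx', abs_of_nonneg (hy'.nonneg _)] at h1
      linarith [hyb (d j) (hmem.1 hj), hδ m hm]
    · linarith [hδ m hm]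

theorem not_hasAveragingOperator_gMap_comp (𝕜 : Type*) [RCLike 𝕜] [Infinite κ]
    (hr : IsDigitSequence r) {X : Type*} [TopologicalSpace X] [CompactSpace X]
    (h : C(X, LSpace r κ)) : ¬ HasAveragingOperator 𝕜 ((gMap hr κ).comp h) := by
  have hval : ∀ x i, (((gMap hr κ).comp h) x).1 i = gFun r (h x) i := fun _ _ => rfl
  have hnn : ∀ x i, 0 ≤ gFun r (h x) i := fun x => (gFun_mem hr (h x)).2
  refine not_hasAveragingOperator_of_controls_gFun 𝕜 hr subset_rfl _ h id
    (fun F => by simp) (fun x i => ⟨i, rfl, le_rfl⟩) (fun x S j => ?_) fun x S => ⟨S, ?_⟩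
  · have := mem_ball_iff.1 (gFun_mem hr (h x)).1 S
    simp only [hval, id]
    linarith [le_abs_self (gFun r (h x) j)]
  · simp only [hval, abs_of_nonneg (hnn x _), le_refl]

theorem not_hasAveragingOperator_diffMap_comp (𝕜 : Type*) [RCLike 𝕜] [Infinite κ]
    (hr : IsDigitSequence r) (e : κ ≃ κ × Bool) {X : Type*} [TopologicalSpace X] [CompactSpace X]
    (h : C(X, LSpace r κ)) :
    ¬ HasAveragingOperator 𝕜 ((diffMap e).comp ((gMap hr κ).comp h)) := by
  classical
  have hval : ∀ x i, (((diffMap e).comp ((gMap hr κ).comp h)) x).1 i =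
      gFun r (h x) (e.symm (i, false)) - gFun r (h x) (e.symm (i, true)) := fun _ _ => rfl
  have hnn : ∀ x i, 0 ≤ gFun r (h x) i := fun x => (gFun_mem hr (h x)).2
  have habs : ∀ x i, |(((diffMap e).comp ((gMap hr κ).comp h)) x).1 i| ≤
      gFun r (h x) (e.symm (i, false)) + gFun r (h x) (e.symm (i, true)) := fun x i => by
    rw [hval, abs_le]
    constructor <;> linarith [hnn x (e.symm (i, false)), hnn x (e.symm (i, true))]
  have hpair : ∀ x (S : Finset κ),
      ∑ j ∈ (S ×ˢ (Finset.univ : Finset Bool)).map e.symm.toEmbedding, gFun r (h x) j =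
      ∑ i ∈ S, (gFun r (h x) (e.symm (i, false)) + gFun r (h x) (e.symm (i, true))) :=
    fun x S => by
      rw [Finset.sum_map, Finset.sum_product]
      exact Finset.sum_congr rfl fun i _ => by simp [add_comm]
  have hle : ∀ x (S : Finset κ), ∑ i ∈ S,
      (gFun r (h x) (e.symm (i, false)) + gFun r (h x) (e.symm (i, true))) ≤ 1 := fun x S => by
    have := mem_ball_iff.1 (gFun_mem hr (h x)).1
      ((S ×ˢ (Finset.univ : Finset Bool)).map e.symm.toEmbedding)
    simpa only [abs_of_nonneg (hnn x _), hpair] using this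
  refine not_hasAveragingOperator_of_controls_gFun 𝕜 hr (fun y hy => hy.1) _ h
    (fun j => (e j).1) (fun F => ?_) (fun x i => ⟨e.symm (i, false), by simp, ?_⟩)
    (fun x S j => ?_) fun x S => ⟨_, (Finset.sum_le_sum fun i _ => habs x i).trans_eq
      (hpair x S).symm⟩
  · refine ((F ×ˢ (Finset.univ : Finset Bool)).map e.symm.toEmbedding).finite_toSet.subset ?_
    intro j hj
    rw [Finset.mem_coe, Finset.mem_map_equiv]
    simpa using hj
  · rw [hval]
    linarith [hnn x (e.symm (i, true))]
  · have hj : gFun r (h x) j ≤ gFun r (h x) (e.symm ((e j).1, false)) +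
        gFun r (h x) (e.symm ((e j).1, true)) := by
      have hej : e.symm ((e j).1, (e j).2) = j := by simp
      cases hb : (e j).2 <;> rw [hb] at hej <;> rw [hej]
      · linarith [hnn x (e.symm ((e j).1, true))]
      · linarith [hnn x (e.symm ((e j).1, false))]
    -- The pair over `(e j).1` has mass at most 1 minus that of the other pairs, which dominates
    -- their absolute differences.
    have h1 := hle x (insert (e j).1 (S.erase (e j).1))
    rw [Finset.sum_insert (Finset.notMem_erase _ _)] at h1
    have h2 := Finset.sum_le_sum fun i (_ : i ∈ S.erase (e j).1) => habs x i
    have h3 : ∑ i ∈ S, |(((diffMap e).comp ((gMap hr κ).comp h)) x).1 i| ≤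
        |(((diffMap e).comp ((gMap hr κ).comp h)) x).1 (e j).1| +
        ∑ i ∈ S.erase (e j).1, |(((diffMap e).comp ((gMap hr κ).comp h)) x).1 i| := by
      rw [← Finset.sum_insert (f := fun i => |(((diffMap e).comp ((gMap hr κ).comp h)) x).1 i|)
        (Finset.notMem_erase _ _)]
      refine Finset.sum_le_sum_of_subset_of_nonneg (fun i hi => ?_) fun i _ _ => abs_nonneg _
      simp only [Finset.mem_insert, Finset.mem_erase]
      tauto
    linarith

end Splitting

theorem proposition9 (𝕜 : Type*) [RCLike 𝕜] (κ : Type u) [Uncountable κ]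
    [TopologicalSpace κ] [DiscreteTopology κ] (r : ℕ → ℝ) (hr : IsDigitSequence r) :
    -- the construction can be carried out
    Nonempty (κ ≃ κ × Bool) ∧
    (∃ h : C(ℕ → OnePoint κ, LSpace r κ), Function.Surjective h) ∧
    -- and, however it is carried out, the resulting surjections have no averaging operator
    ∀ h : C(ℕ → OnePoint κ, LSpace r κ), Function.Surjective h →
      (Function.Surjective ((gMap hr κ).comp h) ∧
        ¬ HasAveragingOperator 𝕜 ((gMap hr κ).comp h)) ∧
      ∀ e : κ ≃ κ × Bool,
        Function.Surjective ((diffMap e).comp ((gMap hr κ).comp h)) ∧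
        ¬ HasAveragingOperator 𝕜 ((diffMap e).comp ((gMap hr κ).comp h)) := by
  refine ⟨?_, exists_surjective_LSpace hr.1, fun h hh => ?_⟩
  · rw [← Cardinal.lift_mk_eq']
    have h2 : (2 : Cardinal.{u}) ≤ Cardinal.mk κ :=
      (Cardinal.ofNat_lt_aleph0 (n := 2)).le.trans (Cardinal.aleph0_le_mk κ)
    simp [Cardinal.mul_eq_left (Cardinal.aleph0_le_mk κ) h2]
  · have hg : Function.Surjective ((gMap hr κ).comp h) := (gMap_surjective hr).comp hh
    exact ⟨⟨hg, not_hasAveragingOperator_gMap_comp 𝕜 hr h⟩, fun e =>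
      ⟨(diffMap_surjective e).comp hg, not_hasAveragingOperator_diffMap_comp 𝕜 hr e h⟩⟩
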